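/- Let $p_1,p_2,p_3\in\mathbb R^2$ and $q_1,q_2,q_3\in\mathbb R^2$ be the vertices of two (non-degenerate) equilateral triangles, and put $L_i(t)=\tfrac12(t+p_i)$, $K_i(t)=\tfrac12(t+q_i)$, $i\in I=\{1,2,3\}$. Let $SG'$ and $SG''$ be the Sierpiński gaskets generated by them, i.e. the unique nonempty compact sets with $SG'=\bigcup_i L_i(SG')$ and $SG''=\bigcup_i K_i(SG'')$. Fix $N\ge 1$ and, for words $\omega,\eta\in I^N$, put $L_\omega=L_{\omega_1}\circ\cdots\circ L_{\omega_N}$ and $K_\eta=K_{\eta_1}\circ\cdots\circ K_{\eta_N}$. For $\omega,\eta\in I^N$ let $\alpha_{\omega\eta},h_{\omega\eta}:SG'\times SG''\to\mathbb R$ be Hölder continuous for the Euclidean metric: all $h_{\omega\eta}$ with an exponent $s_h\in(0,1]$ and a constant $K_h$, and $\alpha_{\omega\eta}$ with an exponent $s_{\alpha_{\omega\eta}}\in(0,1]$ and a constant $K_{\alpha_{\omega\eta}}$. Put $$\|\alpha\|_\infty=\max_{\omega,\eta\in I^N}\ \sup_{SG'\times SG''}|\alpha_{\omega\eta}|,\qquad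 s=\min\Big\{s_h,\ \min_{\omega,\eta\in I^N}s_{\alpha_{\omega\eta}}\Big\}.$$ Let $f:SG'\times SG''\to\mathbb R$ be the fractal interpolation function determined by these maps, that is, a function whose graph $Gr(f)=\{(t,u,f(t,u)):(t,u)\in SG'\times SG''\}\subset\mathbb R^2\times\mathbb R^2\times\mathbb R=\mathbb R^5$ is the attractor of the iterated function system $$W_{\omega\eta}(t,u,x)=\big(L_\omega(t),\,K_\eta(u),\,\alpha_{\omega\eta}(t,u)\,x+h_{\omega\eta}(t,u)\big),\qquad \omega,\eta\in I^N,$$ meaning that $Gr(f)$ is compact (equivalently, $f$ is continuous) and $Gr(f)=\bigcup_{\omega,\eta\in I^N}W_{\omega\eta}(Gr(f))$. If $\|\alpha\|_\infty<2^{-N}$, then $$2\,\frac{\log 3}{\log 2}\ \le\ \dim_H Gr(f)\ \le\ \overline{\dim}_B\, Gr(f)\ \le\ 1-s+2\,\frac{\log 3}{\log 2},$$ where $\dim_H$ denotes the Hausdorff dimension and $\overline{\dim}_B$ the upper box dimension. -/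

import Mathlib

open Set Filter Topology
open scoped NNReal ENNReal

noncomputable section

namespace GasketFIF

/-- The Euclidean plane. -/
abbrev Plane : Type := EuclideanSpace ℝ (Fin 2)

/-- The product of two planes, with the Euclidean norm of `ℝ⁴`. -/
abbrev Plane2 : Type := WithLp 2 (Plane × Plane)

/-- The product of two planes and a line, with the Euclidean norm of `ℝ⁵`. -/
abbrev Space5 : Type := WithLp 2 (Plane2 × ℝ)

/-- `K` is an attractor of the iterated function system `W`: a nonempty compact set with
`K = ⋃ i, W i (K)`. -/
def IsAttractor {X ι : Type*} [TopologicalSpace X] (W : ι → X → X) (K : Set X) : Prop :=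
  K.Nonempty ∧ IsCompact K ∧ K = ⋃ i, W i '' K

/-- The contraction `t ↦ (t + p i) / 2` of the plane. -/
def halfMap (p : Fin 3 → Plane) (i : Fin 3) (t : Plane) : Plane := (1 / 2 : ℝ) • (t + p i)

theorem exists_isAttractor_halfMap (p : Fin 3 → Plane) : ∃ K, IsAttractor (halfMap p) K := by
  let g : ℕ → (ℕ → Fin 3) → Plane := fun k ω => ((1 / 2 : ℝ) ^ (k + 1)) • p (ω k)
  have hb : ∀ k ω, ‖g k ω‖ ≤ (1 / 2 : ℝ) ^ k * ∑ i, ‖p i‖ := by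
    intro k ω
    have h1 : ‖p (ω k)‖ ≤ ∑ i, ‖p i‖ :=
      Finset.single_le_sum (f := fun i => ‖p i‖) (fun i _ => norm_nonneg _) (Finset.mem_univ _)
    have h2 : (1 / 2 : ℝ) ^ (k + 1) ≤ (1 / 2 : ℝ) ^ k :=
      pow_le_pow_of_le_one (by norm_num) (by norm_num) (Nat.le_succ k)
    simp only [g, norm_smul, norm_pow]
    rw [Real.norm_of_nonneg (by norm_num : (0 : ℝ) ≤ 1 / 2)]
    gcongr
  have hs : Summable fun k : ℕ => (1 / 2 : ℝ) ^ k * ∑ i, ‖p i‖ :=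
    (summable_geometric_of_lt_one (by norm_num) (by norm_num)).mul_right _
  have hgs : ∀ ω, Summable fun k => g k ω := fun ω => .of_norm_bounded hs fun k => hb k ω
  have hcont : Continuous fun ω => ∑' k, g k ω := by
    refine continuous_tsum (fun k => ?_) hs hb
    have hp : Continuous p := continuous_of_discreteTopology
    have hk : Continuous fun ω : ℕ → Fin 3 => ω k := continuous_apply k
    exact (hp.comp hk).const_smul ((1 / 2 : ℝ) ^ (k + 1))
  have hstep : ∀ ω, ∑' k, g k ω = halfMap p (ω 0) (∑' k, g k fun n => ω (n + 1)) := by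
    intro ω
    rw [(hgs ω).tsum_eq_zero_add, halfMap, smul_add, ← tsum_const_smul'', add_comm]
    congr 1
    · refine tsum_congr fun k => ?_
      simp only [g, smul_smul]
      congr 1
      ring
    · simp [g]
  refine ⟨range fun ω => ∑' k, g k ω, range_nonempty _, isCompact_range hcont, ?_⟩
  ext x
  simp only [mem_range, mem_iUnion, mem_image, exists_exists_eq_and]
  constructor
  · rintro ⟨ω, rfl⟩
    exact ⟨ω 0, fun n => ω (n + 1), (hstep ω).symm⟩
  · rintro ⟨i, ω, rfl⟩
    exact ⟨fun n => Nat.casesOn n i ω, hstep _⟩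

/-- The Sierpinski gasket with vertices `p`: the attractor of the three maps `halfMap p i`. -/
def gasket (p : Fin 3 → Plane) : Set Plane := Classical.choose (exists_isAttractor_halfMap p)

theorem isAttractor_gasket (p : Fin 3 → Plane) : IsAttractor (halfMap p) (gasket p) :=
  Classical.choose_spec (exists_isAttractor_halfMap p)

theorem IsAttractor.subset_of_halfMap {p : Fin 3 → Plane} {K K' : Set Plane}
    (hK : IsAttractor (halfMap p) K) (hK' : IsAttractor (halfMap p) K') : K ⊆ K' := by
  obtain ⟨x, hx, hmax⟩ := hK.2.1.exists_isMaxOn hK.1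
    (f := fun x => Metric.infDist x K') (Metric.continuous_infDist_pt K').continuousOn
  have h0 : Metric.infDist x K' ≤ 0 := by
    have hx' := hx
    rw [hK.2.2] at hx'
    obtain ⟨i, y, hy, rfl⟩ := mem_iUnion.1 hx'
    obtain ⟨z, hz, hyz⟩ := hK'.2.1.exists_infDist_eq_dist hK'.1 y
    have hz' : halfMap p i z ∈ K' := by
      rw [hK'.2.2]
      exact mem_iUnion.2 ⟨i, z, hz, rfl⟩
    have h1 := Metric.infDist_le_dist_of_mem (x := halfMap p i y) hz'
    have h2 : dist (halfMap p i y) (halfMap p i z) = 1 / 2 * dist y z := by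
      rw [halfMap, halfMap, dist_smul₀, dist_add_right, Real.norm_of_nonneg (by norm_num)]
    have h3 : Metric.infDist y K' ≤ Metric.infDist (halfMap p i y) K' := hmax hy
    linarith
  intro w hw
  have h1 : Metric.infDist w K' ≤ Metric.infDist x K' := hmax hw
  exact (hK'.2.1.isClosed.mem_iff_infDist_zero hK'.1).2
    (le_antisymm (h1.trans h0) Metric.infDist_nonneg)

/-- The gasket is the only attractor of its system. -/
theorem IsAttractor.eq_gasket {p : Fin 3 → Plane} {K : Set Plane}
    (hK : IsAttractor (halfMap p) K) : K = gasket p :=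
  (hK.subset_of_halfMap (isAttractor_gasket p)).antisymm
    ((isAttractor_gasket p).subset_of_halfMap hK)

/-- Words of length `N` over a three-letter alphabet. -/
abbrev Word (N : ℕ) : Type := Fin N → Fin 3

/-- The composition `L_{ω₁} ∘ L_{ω₂} ∘ ⋯ ∘ L_{ω_N}` of the maps `halfMap p i`. -/
def wordMap (p : Fin 3 → Plane) {N : ℕ} (ω : Word N) (t : Plane) : Plane :=
  (List.ofFn ω).foldr (halfMap p) t

/-- The product of the gaskets with vertices `p` and `q`. -/
def gasketProd (p q : Fin 3 → Plane) : Set Plane2 :=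
  {x | x.fst ∈ gasket p ∧ x.snd ∈ gasket q}

/-- The iterated function system
`W_{ωη}(t, s, x) = (L_ω(t), K_η(s), α_{ωη}(t, s) x + h_{ωη}(t, s))`, indexed by pairs of words
of length `N`. -/
def fifSystem (p q : Fin 3 → Plane) {N : ℕ} (α h : Word N × Word N → Plane2 → ℝ)
    (w : Word N × Word N) (x : Space5) : Space5 :=
  WithLp.toLp 2 (WithLp.toLp 2 (wordMap p w.1 x.fst.fst, wordMap q w.2 x.fst.snd),
    α w x.fst * x.snd + h w x.fst)

/-- The graph of `f` over `A`. -/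
def graphOver (A : Set Plane2) (f : Plane2 → ℝ) : Set Space5 :=
  (fun y => WithLp.toLp 2 (y, f y)) '' A

/-- `f`, restricted to the product of the gaskets, is the fractal interpolation function of the
system: its graph is the attractor. Compactness of the graph makes `f` continuous there. -/
def IsFIF (p q : Fin 3 → Plane) {N : ℕ} (α h : Word N × Word N → Plane2 → ℝ)
    (f : Plane2 → ℝ) : Prop :=
  IsAttractor (fifSystem p q α h) (graphOver (gasketProd p q) f)

/-- The maximum over all `w` of the supremum norms of `α w` on `A`. -/
def supNorm {N : ℕ} (A : Set Plane2) (α : Word N × Word N → Plane2 → ℝ) : ℝ :=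
  ⨆ w, ⨆ y : A, |α w y|

/-- The upper box dimension `limsup_{δ → 0+} log N_δ(A) / (-log δ)`, where `N_δ(A)` is the least
number of closed balls of radius `δ` that cover `A`. -/
def upperBoxDim {X : Type*} [PseudoEMetricSpace X] (A : Set X) : EReal :=
  limsup (fun δ : ℝ≥0 => ENNReal.log (Metric.externalCoveringNumber δ A : ℝ≥0∞) /
    ((-Real.log δ : ℝ) : EReal)) (𝓝[>] 0)

end GasketFIF

end

open GasketFIF

/-! Lower bound: in barycentric coordinates with respect to the two triangles, the gasket maps
become `x ↦ (x + e d) / 2` with nine distinct 0-1 vectors `e d`. The image of the graph in these six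
coordinates depends only on the base points and is closed and invariant under the nine maps, so it
contains all points with binary digit vectors among the `e d`. The uniform Bernoulli measure on
digit sequences pushes forward to a measure giving sets of diameter at most `2 ^ (-n)` mass `O(9 ^
(-n))`. By the mass distribution principle the image has dimension at least `log 9 / log 2`, and
smooth maps do not raise dimension (`log_card_div_log_two_le_dimH`, `le_dimH_graphOver_gasketProd`).

Upper bound: put `ρ = 2 ^ (-N)`. Invariance of the graph gives `f (W y) = α y * f y + h y`, so
passing to the next level of cells multiplies oscillation by at most `‖α‖∞` and adds a term `O(ρ ^
(s * n))`. As `‖α‖∞ < ρ ≤ ρ ^ s`, the oscillation on level `n` is `O(ρ ^ (s * n))` (`exists_cells`).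
Over each of the `9 ^ (N * n)` cells, `O(δ ^ (s - 1))` balls of radius `δ ≈ ρ ^ n` cover the graph,
and counting gives the exponent `1 - s + 2 * log 3 / log 2`. -/

namespace GasketFIF

/-! ### Upper box dimension and its comparison with Hausdorff dimension. -/

section BoxDimension

open MeasureTheory Metric

theorem upperBoxDim_nonneg {X : Type*} [PseudoEMetricSpace X] {A : Set X} (hA : A.Nonempty) :
    0 ≤ upperBoxDim A := by
  have h : ∀ᶠ δ : ℝ≥0 in 𝓝[>] 0, (0 : EReal) ≤
      ENNReal.log (externalCoveringNumber δ A : ℝ≥0∞) / ((-Real.log δ : ℝ) : EReal) := by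
    filter_upwards [Ioo_mem_nhdsGT (zero_lt_one' ℝ≥0)] with δ hδ
    refine EReal.div_nonneg ?_ ?_
    · rw [ENNReal.zero_le_log_iff]
      have h1 : (1 : ℕ∞) ≤ externalCoveringNumber δ A :=
        Order.one_le_iff_pos.2 (externalCoveringNumber_pos_iff.2 hA)
      exact_mod_cast h1
    · have := Real.log_nonpos δ.coe_nonneg (by exact_mod_cast hδ.2.le)
      exact_mod_cast (by linarith : (0 : ℝ) ≤ -Real.log δ)
  calc (0 : EReal) = limsup (fun _ : ℝ≥0 => (0 : EReal)) (𝓝[>] 0) := by simp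
    _ ≤ upperBoxDim A := limsup_le_limsup h

/-- For small `δ` at most `δ ^ (-d)` balls of diameter at most `2 * δ` suffice, so their
`d`-dimensional sum is at most `2 ^ d`, and the `d`-dimensional Hausdorff measure is finite. -/
theorem dimH_le_of_upperBoxDim_lt {X : Type*} [EMetricSpace X] {A : Set X} {d : ℝ≥0}
    (hd : upperBoxDim A < ((d : ℝ) : EReal)) : dimH A ≤ d := by
  borelize X
  have h1 : ∀ᶠ δ : ℝ≥0 in 𝓝[>] 0,
      (externalCoveringNumber δ A : ℝ≥0∞) ≤ (δ : ℝ≥0∞) ^ (-(d : ℝ)) := by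
    filter_upwards [Ioo_mem_nhdsGT (zero_lt_one' ℝ≥0), eventually_lt_of_limsup_lt hd] with δ hδ h
    have hpos : 0 < -Real.log δ := by
      have := Real.log_neg (by exact_mod_cast hδ.1) (by exact_mod_cast hδ.2 : (δ : ℝ) < 1)
      linarith
    rw [EReal.div_lt_iff (by exact_mod_cast hpos) (EReal.coe_ne_top _)] at h
    rw [← ENNReal.log_le_log_iff, ENNReal.log_rpow, ENNReal.log_of_nnreal hδ.1.ne']
    refine h.le.trans (le_of_eq ?_)
    norm_cast
    ring
  have h2 : ∀ δ : ℝ≥0, ∃ C : Finset X,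
      (externalCoveringNumber δ A : ℝ≥0∞) ≤ (δ : ℝ≥0∞) ^ (-(d : ℝ)) → 0 < δ →
        IsCover δ A (C : Set X) ∧ (C.card : ℝ≥0∞) ≤ (δ : ℝ≥0∞) ^ (-(d : ℝ)) := by
    intro δ
    by_cases h : (externalCoveringNumber δ A : ℝ≥0∞) ≤ (δ : ℝ≥0∞) ^ (-(d : ℝ)) ∧ 0 < δ
    · obtain ⟨h, hδ⟩ := h
      have hne : Nonempty {C : Set X // IsCover δ A C} := ⟨⟨A, .rfl⟩⟩
      -- Covering numbers lie in `ℕ∞`, so the infimum is attained by an actual cover.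
      obtain ⟨⟨C, hC⟩, hCe⟩ := ENat.exists_eq_iInf fun C : {C : Set X // IsCover δ A C} =>
        (C : Set X).encard
      have hCe' : C.encard = externalCoveringNumber δ A := by
        rw [externalCoveringNumber, iInf_subtype']
        exact hCe
      rw [← hCe'] at h
      have hfin : C.Finite := by
        rw [← Set.encard_lt_top_iff]
        have h3 : (C.encard : ℝ≥0∞) < ⊤ := h.trans_lt
          (ENNReal.rpow_ne_top_of_ne_zero (by exact_mod_cast hδ.ne') ENNReal.coe_ne_top).lt_top
        exact_mod_cast h3
      refine ⟨hfin.toFinset, fun _ _ => ⟨by simpa using hC, ?_⟩⟩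
      rw [hfin.encard_eq_coe_toFinset_card] at h
      exact_mod_cast h
    · exact ⟨∅, fun h3 h4 => absurd ⟨h3, h4⟩ h⟩
  choose C hC using h2
  have hpos : ∀ᶠ δ : ℝ≥0 in 𝓝[>] 0, 0 < δ := self_mem_nhdsWithin
  have hr : Tendsto (fun δ : ℝ≥0 => 2 * (δ : ℝ≥0∞)) (𝓝[>] 0) (𝓝 0) := by
    have : Tendsto (fun δ : ℝ≥0 => ((2 * δ : ℝ≥0) : ℝ≥0∞)) (𝓝 0) (𝓝 ((2 * 0 : ℝ≥0) : ℝ≥0∞)) :=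
      Continuous.tendsto (by fun_prop) 0
    simpa using this.mono_left nhdsWithin_le_nhds
  have h3 := Measure.hausdorffMeasure_le_liminf_sum (d : ℝ) A (l := 𝓝[>] (0 : ℝ≥0))
    (fun δ => 2 * (δ : ℝ≥0∞)) hr (ι := fun δ => C δ) (fun δ c => closedEBall (c : X) δ)
    (Eventually.of_forall fun δ c => ediam_closedEBall_le)
    (by
      filter_upwards [h1, hpos] with δ h hδ
      have := isCover_iff_subset_iUnion_closedEBall.1 (hC δ h hδ).1
      simpa [iUnion_subtype] using this)
  refine dimH_le_of_hausdorffMeasure_ne_top (ne_top_of_le_ne_top (b := (2 : ℝ≥0∞) ^ (d : ℝ))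
    (by finiteness) (h3.trans ?_))
  rw [← liminf_const (f := 𝓝[>] (0 : ℝ≥0)) ((2 : ℝ≥0∞) ^ (d : ℝ))]
  refine liminf_le_liminf ?_
  filter_upwards [h1, hpos] with δ h hδ
  have hδ0 : (δ : ℝ≥0∞) ≠ 0 := by exact_mod_cast hδ.ne'
  calc ∑ c : C δ, ediam (closedEBall (c : X) δ) ^ (d : ℝ)
      ≤ ∑ c : C δ, (2 * (δ : ℝ≥0∞)) ^ (d : ℝ) := by
        gcongr
        exact ediam_closedEBall_le
    _ = (C δ).card * (2 ^ (d : ℝ) * (δ : ℝ≥0∞) ^ (d : ℝ)) := by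
        rw [ENNReal.mul_rpow_of_nonneg _ _ d.coe_nonneg]
        simp
    _ ≤ (δ : ℝ≥0∞) ^ (-(d : ℝ)) * (2 ^ (d : ℝ) * (δ : ℝ≥0∞) ^ (d : ℝ)) := by
        gcongr
        exact (hC δ h hδ).2
    _ = 2 ^ (d : ℝ) := by
        rw [mul_left_comm, ← ENNReal.rpow_add _ _ hδ0 ENNReal.coe_ne_top]
        simp

/-- The Hausdorff dimension is at most the upper box dimension. -/
theorem dimH_le_upperBoxDim {X : Type*} [EMetricSpace X] {A : Set X} (hA : A.Nonempty) :
    (dimH A : EReal) ≤ upperBoxDim A := by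
  by_contra! h
  obtain ⟨x, hx1, hx2⟩ := EReal.lt_iff_exists_real_btwn.1 h
  have hx0 : 0 ≤ x := by exact_mod_cast (upperBoxDim_nonneg hA).trans hx1.le
  lift x to ℝ≥0 using hx0
  have h1 := dimH_le_of_upperBoxDim_lt hx1
  have h2 : (dimH A : EReal) ≤ ((x : ℝ≥0∞) : EReal) := by exact_mod_cast h1
  exact absurd (hx2.trans_le h2) (lt_irrefl _)

/-- The constant contributes `log C / (-log δ)`, which tends to zero. -/
theorem upperBoxDim_le_of_eventually_le {X : Type*} [PseudoEMetricSpace X] {A : Set X} {C D : ℝ}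
    (hC : 0 < C) (h : ∀ᶠ δ : ℝ≥0 in 𝓝[>] 0,
      (externalCoveringNumber δ A : ℝ≥0∞) ≤ ENNReal.ofReal (C * (δ : ℝ) ^ (-D))) :
    upperBoxDim A ≤ (D : EReal) := by
  have hlog : Tendsto (fun δ : ℝ≥0 => -Real.log δ) (𝓝[>] 0) atTop := by
    refine tendsto_neg_atBot_atTop.comp (Real.tendsto_log_nhdsGT_zero.comp ?_)
    refine tendsto_nhdsWithin_iff.2 ⟨?_, ?_⟩
    · exact (NNReal.continuous_coe.tendsto 0).mono_left nhdsWithin_le_nhds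
    · filter_upwards [self_mem_nhdsWithin] with δ hδ
      exact_mod_cast hδ
  have hlim : Tendsto (fun δ : ℝ≥0 => ((Real.log C / (-Real.log δ) + D : ℝ) : EReal)) (𝓝[>] 0)
      (𝓝 (D : EReal)) := by
    refine (continuous_coe_real_ereal.tendsto D).comp ?_
    simpa using (hlog.const_div_atTop (Real.log C)).add_const D
  rw [← hlim.limsup_eq]
  refine limsup_le_limsup ?_
  filter_upwards [Ioo_mem_nhdsGT (zero_lt_one' ℝ≥0), h] with δ hδ hle
  have hδ0 : (0 : ℝ) < δ := by exact_mod_cast hδ.1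
  have hpos : 0 < -Real.log δ := by
    have := Real.log_neg hδ0 (by exact_mod_cast hδ.2 : (δ : ℝ) < 1)
    linarith
  rw [EReal.div_le_iff_le_mul (by exact_mod_cast hpos) (EReal.coe_ne_top _), ← EReal.coe_mul]
  refine (ENNReal.log_le_log hle).trans (le_of_eq ?_)
  rw [ENNReal.log_ofReal_of_pos (by positivity), Real.log_mul hC.ne' (by positivity),
    Real.log_rpow hδ0, mul_add, mul_div_cancel₀ _ hpos.ne']
  congr 1
  ring

end BoxDimension

/-! ### Binary digit sets and the Bernoulli measure on them. -/

section DigitSets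

open MeasureTheory

variable {D ι : Type*}

/-- The integer whose binary digits are the coordinates of `e (ω 0), …, e (ω (n - 1))`. -/
def digitInt (e : D → ι → ℤ) (ω : ℕ → D) : ℕ → ι → ℤ
  | 0 => 0
  | n + 1 => 2 * digitInt e ω n + e (ω n)

/-- The point whose coordinates have the binary digits `e (ω 0), e (ω 1), …`. -/
noncomputable def digitLimit (e : D → ι → ℤ) (ω : ℕ → D) (i : ι) : ℝ :=
  ⨆ n, (digitInt e ω n i : ℝ) / 2 ^ n

theorem digitInt_succ_apply (e : D → ι → ℤ) (ω : ℕ → D) (n : ℕ) (i : ι) :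
    digitInt e ω (n + 1) i = 2 * digitInt e ω n i + e (ω n) i := rfl

/-- Parity recovers the last 0-1 digit in each coordinate, and halving recovers the rest. -/
theorem digitInt_inj {e : D → ι → ℤ} (he : Function.Injective e)
    (h01 : ∀ d i, 0 ≤ e d i ∧ e d i ≤ 1) {ω ω' : ℕ → D} {n : ℕ}
    (h : digitInt e ω n = digitInt e ω' n) : ∀ k < n, ω k = ω' k := by
  induction n with
  | zero => intro k hk; omega
  | succ n ih =>
    have h1 : ∀ i, digitInt e ω n i = digitInt e ω' n i ∧ e (ω n) i = e (ω' n) i := by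
      intro i
      have h2 := congrFun h i
      rw [digitInt_succ_apply, digitInt_succ_apply] at h2
      have := h01 (ω n) i
      have := h01 (ω' n) i
      omega
    intro k hk
    rcases Nat.lt_succ_iff_lt_or_eq.1 hk with hk | rfl
    · exact ih (funext fun i => (h1 i).1) k hk
    · exact he (funext fun i => (h1 i).2)

/-- Appending a digit in `[0, 1]` selects a subinterval of the current dyadic interval; this is the
monotonicity of the left endpoints. -/
theorem monotone_digitInt_div {e : D → ι → ℤ} (h01 : ∀ d i, 0 ≤ e d i ∧ e d i ≤ 1) (ω : ℕ → D)
    (i : ι) : Monotone fun n => (digitInt e ω n i : ℝ) / 2 ^ n := by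
  refine monotone_nat_of_le_succ fun n => ?_
  have h : (0 : ℝ) ≤ e (ω n) i := by exact_mod_cast (h01 (ω n) i).1
  rw [digitInt_succ_apply, pow_succ, div_le_div_iff₀ (by positivity) (by positivity)]
  push_cast
  nlinarith [pow_pos (zero_lt_two' ℝ) n]

theorem antitone_digitInt_add_one_div {e : D → ι → ℤ} (h01 : ∀ d i, 0 ≤ e d i ∧ e d i ≤ 1)
    (ω : ℕ → D) (i : ι) : Antitone fun n => ((digitInt e ω n i : ℝ) + 1) / 2 ^ n := by
  refine antitone_nat_of_succ_le fun n => ?_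
  have h : (e (ω n) i : ℝ) ≤ 1 := by exact_mod_cast (h01 (ω n) i).2
  rw [digitInt_succ_apply, pow_succ, div_le_div_iff₀ (by positivity) (by positivity)]
  push_cast
  nlinarith [pow_pos (zero_lt_two' ℝ) n]

theorem tendsto_digitInt_div {e : D → ι → ℤ} (h01 : ∀ d i, 0 ≤ e d i ∧ e d i ≤ 1) (ω : ℕ → D)
    (i : ι) : Tendsto (fun n => (digitInt e ω n i : ℝ) / 2 ^ n) atTop (𝓝 (digitLimit e ω i)) := by
  refine tendsto_atTop_ciSup (monotone_digitInt_div h01 ω i) ⟨1, ?_⟩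
  rintro _ ⟨n, rfl⟩
  have h := antitone_digitInt_add_one_div h01 ω i (Nat.zero_le n)
  simp only [digitInt, Pi.zero_apply, Int.cast_zero, zero_add, pow_zero, div_one] at h
  refine le_trans (div_le_div_of_nonneg_right ?_ (by positivity)) h
  linarith

theorem digitInt_le_two_pow_mul {e : D → ι → ℤ} (h01 : ∀ d i, 0 ≤ e d i ∧ e d i ≤ 1) (ω : ℕ → D)
    (n : ℕ) (i : ι) : (digitInt e ω n i : ℝ) ≤ 2 ^ n * digitLimit e ω i := by
  have h := (monotone_digitInt_div h01 ω i).ge_of_tendsto (tendsto_digitInt_div h01 ω i) n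
  rwa [div_le_iff₀' (by positivity)] at h

theorem two_pow_mul_le_digitInt_add_one {e : D → ι → ℤ} (h01 : ∀ d i, 0 ≤ e d i ∧ e d i ≤ 1)
    (ω : ℕ → D) (n : ℕ) (i : ι) : 2 ^ n * digitLimit e ω i ≤ digitInt e ω n i + 1 := by
  have hlim : Tendsto (fun n => ((digitInt e ω n i : ℝ) + 1) / 2 ^ n) atTop
      (𝓝 (digitLimit e ω i)) := by
    have h0 : Tendsto (fun n : ℕ => (1 / 2 : ℝ) ^ n) atTop (𝓝 0) :=
      tendsto_pow_atTop_nhds_zero_of_lt_one (by norm_num) (by norm_num)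
    have := (tendsto_digitInt_div h01 ω i).add h0
    rw [add_zero] at this
    refine this.congr fun n => ?_
    rw [one_div, inv_pow, add_div, one_div]
  have h := (antitone_digitInt_add_one_div h01 ω i).le_of_tendsto hlim n
  rwa [le_div_iff₀' (by positivity)] at h

theorem measurable_digitLimit [Finite D] [MeasurableSpace D] [MeasurableSingletonClass D]
    (e : D → ι → ℤ) : Measurable (digitLimit e) := by
  have h : ∀ n i, Measurable fun ω => digitInt e ω n i := by
    intro n i
    induction n with
    | zero => exact measurable_const
    | succ n ih =>
      have h1 : Measurable fun d => e d i := measurable_of_countable _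
      exact (ih.const_mul 2).add (h1.comp (measurable_pi_apply n))
  refine measurable_pi_lambda _ fun i => Measurable.iSup fun n => ?_
  exact ((measurable_of_countable (fun z : ℤ => (z : ℝ))).comp (h n i)).div_const _

/-- A closed set invariant under the maps `x ↦ (x + e d) / 2` contains every digit limit. -/
theorem digitLimit_mem {e : D → ι → ℤ} (h01 : ∀ d i, 0 ≤ e d i ∧ e d i ≤ 1) {G : Set (ι → ℝ)}
    (hne : G.Nonempty) (hG : IsClosed G)
    (hinv : ∀ d, ∀ x ∈ G, (fun i => (x i + e d i) / 2) ∈ G) (ω : ℕ → D) :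
    digitLimit e ω ∈ G := by
  -- The composite of the first `n` maps, with `ω 0` outermost. The induction applies the new
  -- innermost map to `x` first.
  have hmem : ∀ n, ∀ x ∈ G, (fun i => (digitInt e ω n i + x i) / 2 ^ n) ∈ G := by
    intro n
    induction n with
    | zero => intro x hx; simpa [digitInt] using hx
    | succ n ih =>
      intro x hx
      convert ih _ (hinv (ω n) x hx) using 2 with i
      rw [digitInt_succ_apply, pow_succ]
      push_cast
      field_simp
      ring
  obtain ⟨x, hx⟩ := hne
  refine hG.mem_of_tendsto (b := atTop) (tendsto_pi_nhds.2 fun i => ?_)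
    (Eventually.of_forall fun n => hmem n x hx)
  have h0 : Tendsto (fun n : ℕ => x i * (1 / 2 : ℝ) ^ n) atTop (𝓝 (x i * 0)) :=
    (tendsto_pow_atTop_nhds_zero_of_lt_one (by norm_num) (by norm_num)).const_mul _
  have := (tendsto_digitInt_div h01 ω i).add h0
  rw [mul_zero, add_zero] at this
  refine this.congr fun n => ?_
  rw [one_div, inv_pow, add_div, div_eq_mul_inv (x i)]

variable [Fintype D] [Nonempty D] [MeasurableSpace D] [MeasurableSingletonClass D]

/-- The uniform Bernoulli measure on sequences of digits. -/
noncomputable def bernoulli (D : Type*) [Fintype D] [Nonempty D] [MeasurableSpace D] :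
    Measure (ℕ → D) :=
  Measure.infinitePi fun _ => (PMF.uniformOfFintype D).toMeasure

instance : IsProbabilityMeasure (bernoulli D) := by
  unfold bernoulli
  infer_instance

theorem bernoulli_agree (ω : ℕ → D) (n : ℕ) :
    bernoulli D {ω' | ∀ k < n, ω' k = ω k} = ((Fintype.card D : ℝ≥0∞) ^ n)⁻¹ := by
  have h : {ω' : ℕ → D | ∀ k < n, ω' k = ω k} =
      Set.pi (Finset.range n) fun k => {ω k} := by
    ext
    simp
  rw [h, bernoulli, Measure.infinitePi_pi _ fun _ _ => measurableSet_singleton _]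
  simp only [PMF.toMeasure_apply_singleton _ _ (measurableSet_singleton _),
    PMF.uniformOfFintype_apply, Finset.prod_const, Finset.card_range, ENNReal.inv_pow]

theorem bernoulli_digitInt_eq_le {e : D → ι → ℤ} (he : Function.Injective e)
    (h01 : ∀ d i, 0 ≤ e d i ∧ e d i ≤ 1) (n : ℕ) (v : ι → ℤ) :
    bernoulli D {ω | digitInt e ω n = v} ≤ ((Fintype.card D : ℝ≥0∞) ^ n)⁻¹ := by
  rcases {ω | digitInt e ω n = v}.eq_empty_or_nonempty with h | ⟨ω, hω⟩
  · simp [h]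
  · rw [← bernoulli_agree ω n]
    refine measure_mono fun ω' hω' => ?_
    exact digitInt_inj he h01 (hω'.trans hω.symm)

variable [Fintype ι]

theorem bernoulli_digitLimit_closedBall_le {e : D → ι → ℤ} (he : Function.Injective e)
    (h01 : ∀ d i, 0 ≤ e d i ∧ e d i ≤ 1) (x : ι → ℝ) (n : ℕ) :
    bernoulli D (digitLimit e ⁻¹' Metric.closedBall x ((1 / 2) ^ n)) ≤
      4 ^ Fintype.card ι * ((Fintype.card D : ℝ≥0∞) ^ n)⁻¹ := by
  classical
  let V : Finset (ι → ℤ) :=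
    -- In each coordinate `2 ^ n` times the limit is within 1 of `2 ^ n * x i`, and the digit
    -- integer is at most 1 below it. Hence it lies in `[2 ^ n * x i - 2, 2 ^ n * x i + 1]`, which
    -- leaves four candidates.
    Fintype.piFinset fun i => Finset.Icc (⌊2 ^ n * x i⌋ - 2) (⌊2 ^ n * x i⌋ + 1)
  have hV : V.card = 4 ^ Fintype.card ι := by
    simp only [V, Fintype.card_piFinset, Int.card_Icc]
    rw [Finset.prod_congr rfl (g := fun _ => 4) (fun i _ => by omega)]
    simp
  have hsub : digitLimit e ⁻¹' Metric.closedBall x ((1 / 2) ^ n) ⊆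
      ⋃ v ∈ V, {ω | digitInt e ω n = v} := by
    intro ω hω
    simp only [mem_iUnion, mem_ofPred_eq, exists_prop, exists_eq_right', V, Fintype.mem_piFinset,
      Finset.mem_Icc]
    intro i
    have h1 : |digitLimit e ω i - x i| ≤ (1 / 2) ^ n :=
      (dist_le_pi_dist (digitLimit e ω) x i).trans hω
    have h2 : |2 ^ n * digitLimit e ω i - 2 ^ n * x i| ≤ 1 := by
      rw [← mul_sub, abs_mul, abs_of_pos (by positivity : (0 : ℝ) < 2 ^ n)]
      calc (2 : ℝ) ^ n * |digitLimit e ω i - x i| ≤ 2 ^ n * (1 / 2) ^ n := by gcongr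
        _ = 1 := by rw [← mul_pow]; norm_num
    rw [abs_le] at h2
    have h3 := digitInt_le_two_pow_mul h01 ω n i
    have h4 := two_pow_mul_le_digitInt_add_one h01 ω n i
    have h5 := Int.floor_le (2 ^ n * x i)
    constructor
    · have : ((⌊2 ^ n * x i⌋ - 2 : ℤ) : ℝ) ≤ digitInt e ω n i := by
        push_cast
        linarith
      exact_mod_cast this
    · rw [← sub_le_iff_le_add, Int.le_floor]
      push_cast
      linarith
  calc bernoulli D (digitLimit e ⁻¹' Metric.closedBall x ((1 / 2) ^ n))
      ≤ ∑ v ∈ V, bernoulli D {ω | digitInt e ω n = v} :=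
        (measure_mono hsub).trans (measure_biUnion_finset_le _ _)
    _ ≤ ∑ v ∈ V, ((Fintype.card D : ℝ≥0∞) ^ n)⁻¹ := by
        gcongr with v
        exact bernoulli_digitInt_eq_le he h01 n v
    _ = _ := by simp [hV]

theorem bernoulli_map_digitLimit_le {e : D → ι → ℤ} (he : Function.Injective e)
    (h01 : ∀ d i, 0 ≤ e d i ∧ e d i ≤ 1) (s : Set (ι → ℝ)) (n : ℕ)
    (hs : Metric.ediam s ≤ (1 / 2) ^ n) :
    (bernoulli D).map (digitLimit e) s ≤
      4 ^ Fintype.card ι * ((Fintype.card D : ℝ≥0∞) ^ n)⁻¹ := by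
  rcases s.eq_empty_or_nonempty with rfl | ⟨x, hx⟩
  · simp
  · have hsub : s ⊆ Metric.closedBall x ((1 / 2) ^ n) := by
      intro y hy
      have h1 := (Metric.edist_le_ediam_of_mem hy hx).trans hs
      rw [Metric.mem_closedBall, dist_edist]
      refine ENNReal.toReal_le_of_le_ofReal (by positivity) (h1.trans (le_of_eq ?_))
      rw [ENNReal.ofReal_pow (by norm_num), ENNReal.ofReal_div_of_pos (by norm_num)]
      simp
    refine (measure_mono hsub).trans ?_
    rw [Measure.map_apply (measurable_digitLimit e) measurableSet_closedBall]
    exact bernoulli_digitLimit_closedBall_le he h01 x n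

/-- The diameter is squeezed between consecutive powers of `1 / 2`; the mismatch of one level costs
the factor `card D`. -/
theorem bernoulli_map_digitLimit_le_ediam_rpow {e : D → ι → ℤ} (he : Function.Injective e)
    (h01 : ∀ d i, 0 ≤ e d i ∧ e d i ≤ 1) (hD : 1 < Fintype.card D) (s : Set (ι → ℝ))
    (hs : Metric.ediam s ≤ 1) :
    (bernoulli D).map (digitLimit e) s ≤ 4 ^ Fintype.card ι * Fintype.card D *
      Metric.ediam s ^ (Real.log (Fintype.card D) / Real.log 2) := by
  have hc0 : (Fintype.card D : ℝ≥0∞) ≠ 0 := by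
    simp [Fintype.card_ne_zero]
  have hpow : ∀ n : ℕ, ((1 / 2 : ℝ≥0∞) ^ n) ^ (Real.log (Fintype.card D) / Real.log 2) =
      ((Fintype.card D : ℝ≥0∞) ^ n)⁻¹ := by
    intro n
    have h2 : (2 : ℝ) ^ (Real.log (Fintype.card D) / Real.log 2) = Fintype.card D := by
      rw [Real.rpow_def_of_pos (by norm_num), mul_div_cancel₀ _ (Real.log_pos (by norm_num)).ne',
        Real.exp_log (by exact_mod_cast (zero_lt_one.trans hD))]
    have h3 : (2 : ℝ≥0∞) ^ (Real.log (Fintype.card D) / Real.log 2) = Fintype.card D := by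
      rw [← ENNReal.ofReal_ofNat, ENNReal.ofReal_rpow_of_pos (by norm_num), h2,
        ENNReal.ofReal_natCast]
    rw [← ENNReal.rpow_natCast, ← ENNReal.rpow_mul, mul_comm (n : ℝ), ENNReal.rpow_mul, one_div,
      ENNReal.inv_rpow, h3, ENNReal.rpow_natCast, ENNReal.inv_pow]
  -- With diameter zero the dyadic bound holds at every level, so the mass vanishes because `card D
  -- > 1`.
  rcases eq_or_ne (Metric.ediam s) 0 with h0 | h0
  · have hlim : Tendsto (fun n : ℕ => 4 ^ Fintype.card ι * ((Fintype.card D : ℝ≥0∞) ^ n)⁻¹) atTop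
        (𝓝 (4 ^ Fintype.card ι * 0)) := by
      refine ENNReal.Tendsto.const_mul ?_ (Or.inr (by finiteness))
      simp_rw [ENNReal.inv_pow]
      refine ENNReal.tendsto_pow_atTop_nhds_zero_of_lt_one ?_
      rw [ENNReal.inv_lt_one]
      exact_mod_cast hD
    have := ge_of_tendsto' hlim fun n => bernoulli_map_digitLimit_le he h01 s n (by simp [h0])
    rw [mul_zero] at this
    exact this.trans zero_le
  · obtain ⟨n, hn1, hn2⟩ : ∃ n : ℕ, (1 / 2 : ℝ≥0∞) ^ (n + 1) < Metric.ediam s ∧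
        Metric.ediam s ≤ (1 / 2) ^ n := by
      have hex : ∃ n : ℕ, (1 / 2 : ℝ≥0∞) ^ (n + 1) < Metric.ediam s := by
        have hlim : Tendsto (fun n : ℕ => (1 / 2 : ℝ≥0∞) ^ (n + 1)) atTop (𝓝 0) :=
          (ENNReal.tendsto_pow_atTop_nhds_zero_of_lt_one
            (ENNReal.div_lt_of_lt_mul (by norm_num))).comp (tendsto_add_atTop_nat 1)
        exact (hlim.eventually_lt_const (pos_iff_ne_zero.2 h0)).exists
      classical
      refine ⟨Nat.find hex, Nat.find_spec hex, ?_⟩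
      rcases h : Nat.find hex with _ | m
      · simpa using hs
      · exact not_lt.1 (Nat.find_min hex (by omega))
    refine (bernoulli_map_digitLimit_le he h01 s n hn2).trans ?_
    rw [mul_assoc]
    gcongr
    calc ((Fintype.card D : ℝ≥0∞) ^ n)⁻¹
        = Fintype.card D * ((Fintype.card D : ℝ≥0∞) ^ (n + 1))⁻¹ := by
          rw [pow_succ', ENNReal.mul_inv (Or.inl hc0) (Or.inl (by finiteness)), ← mul_assoc,
            ENNReal.mul_inv_cancel hc0 (by finiteness), one_mul]
      _ ≤ _ := by
          rw [← hpow]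
          gcongr

end DigitSets

/-! ### Hausdorff dimension of digit sets from below. -/

section DigitSetDimension

open MeasureTheory

/-- A nonempty closed set invariant under the maps `x ↦ (x + e d) / 2`, for distinct `0`-`1` vectors
`e d`, has Hausdorff dimension at least `log (card D) / log 2`. -/
theorem log_card_div_log_two_le_dimH {D ι : Type*} [Fintype D] [Nonempty D] [Fintype ι]
    {e : D → ι → ℤ} (he : Function.Injective e)
    (h01 : ∀ d i, 0 ≤ e d i ∧ e d i ≤ 1) (hD : 1 < Fintype.card D) {G : Set (ι → ℝ)}
    (hne : G.Nonempty) (hG : IsClosed G)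
    (hinv : ∀ d, ∀ x ∈ G, (fun i => (x i + e d i) / 2) ∈ G) :
    ENNReal.ofReal (Real.log (Fintype.card D) / Real.log 2) ≤ dimH G := by
  let _ : MeasurableSpace D := ⊤
  have hd : 0 ≤ Real.log (Fintype.card D) / Real.log 2 :=
    div_nonneg (Real.log_nonneg (by exact_mod_cast hD.le)) (Real.log_nonneg (by norm_num))
  set c : ℝ≥0∞ := 4 ^ Fintype.card ι * Fintype.card D with hc
  have hc0 : c ≠ 0 := by simp [hc, Fintype.card_ne_zero]
  have hct : c ≠ ⊤ := by rw [hc]; finiteness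
  -- Mass distribution principle: the rescaled measure lies below Hausdorff measure, yet gives `G`
  -- positive mass.
  have hle : c⁻¹ • (bernoulli D).map (digitLimit e) ≤
      μH[Real.log (Fintype.card D) / Real.log 2] := by
    refine Measure.le_hausdorffMeasure _ _ 1 one_pos fun s hs => ?_
    rw [Measure.smul_apply, smul_eq_mul]
    calc _ ≤ c⁻¹ * (c * Metric.ediam s ^ (Real.log (Fintype.card D) / Real.log 2)) := by
          gcongr
          exact bernoulli_map_digitLimit_le_ediam_rpow he h01 hD s hs
      _ = _ := by rw [← mul_assoc, ENNReal.inv_mul_cancel hc0 hct, one_mul]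
  have hG1 : 1 ≤ (bernoulli D).map (digitLimit e) G := by
    rw [Measure.map_apply (measurable_digitLimit e) hG.measurableSet]
    rw [show digitLimit e ⁻¹' G = univ from
      eq_univ_of_forall fun ω => digitLimit_mem h01 hne hG hinv ω, measure_univ]
  have hpos : μH[((Real.log (Fintype.card D) / Real.log 2).toNNReal : ℝ)] G ≠ 0 := by
    rw [Real.coe_toNNReal _ hd]
    refine (lt_of_lt_of_le ?_ (hle G)).ne'
    rw [Measure.smul_apply, smul_eq_mul]
    exact ENNReal.mul_pos (ENNReal.inv_ne_zero.2 hct) (one_pos.trans_le hG1).ne'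
  exact le_dimH_of_hausdorffMeasure_ne_zero hpos

end DigitSetDimension

/-! ### Oscillation on the cells of an iterated function system. -/

section Cells

/-- If `f` distorts oscillations under the maps `F w` by at most a factor `a < ρ ^ s`, up to a
Hölder term, then its oscillation on cells of level `n` is `O (ρ ^ (s * n))`. -/
theorem exists_cells {X ι : Type*} [PseudoMetricSpace X] [Fintype ι] {A : Set X} {F : ι → X → X}
    {f : X → ℝ} {ρ a K R M s : ℝ} (hρ : 0 < ρ) (hs : 0 ≤ s) (ha0 : 0 ≤ a) (ha : a < ρ ^ s)
    (hK : 0 ≤ K) (hR : 0 ≤ R) (hcov : A ⊆ ⋃ w, F w '' A) (hmaps : ∀ w, MapsTo (F w) A A)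
    (hdist : ∀ w, ∀ y ∈ A, ∀ y' ∈ A, dist (F w y) (F w y') ≤ ρ * dist y y')
    (hosc : ∀ w, ∀ y ∈ A, ∀ y' ∈ A,
      |f (F w y) - f (F w y')| ≤ a * |f y - f y'| + K * dist y y' ^ s)
    (hdiam : ∀ y ∈ A, ∀ y' ∈ A, dist y y' ≤ R) (hM : ∀ y ∈ A, ∀ y' ∈ A, |f y - f y'| ≤ M) :
    ∃ O, 0 ≤ O ∧ ∀ n : ℕ, ∃ T : Finset (Set X), T.card ≤ Fintype.card ι ^ n ∧
      A ⊆ ⋃ c ∈ T, c ∧ ∀ c ∈ T, c ⊆ A ∧ ∀ y ∈ c, ∀ y' ∈ c,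
        dist y y' ≤ R * ρ ^ n ∧ |f y - f y'| ≤ O * (ρ ^ n) ^ s := by
  classical
  have hpos : 0 < ρ ^ s - a := sub_pos.2 ha
  -- The second entry makes `a * O + K * R ^ s ≤ O * ρ ^ s`, which closes the induction; `M` serves
  -- level zero.
  set O := max M (K * R ^ s / (ρ ^ s - a)) with hO
  have hO1 : K * R ^ s ≤ O * (ρ ^ s - a) := (div_le_iff₀ hpos).1 (le_max_right _ _)
  refine ⟨O, (by positivity : 0 ≤ K * R ^ s / (ρ ^ s - a)).trans (le_max_right _ _), ?_⟩
  intro n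
  induction n with
  | zero =>
    refine ⟨{A}, by simp, by simp, fun c hc => ?_⟩
    obtain rfl := Finset.mem_singleton.1 hc
    refine ⟨Subset.rfl, fun y hy y' hy' => ?_⟩
    simp only [pow_zero, mul_one, Real.one_rpow]
    exact ⟨hdiam y hy y' hy', (hM y hy y' hy').trans (le_max_left _ _)⟩
  | succ n ih =>
    obtain ⟨T, hcard, hTcov, hT⟩ := ih
    -- New maps are applied on the outside, so `hdist` and `hosc` pass directly from an old cell to
    -- its image.
    refine ⟨Finset.image₂ (fun w c => F w '' c) Finset.univ T, ?_, ?_, ?_⟩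
    · refine (Finset.card_image₂_le _ _ _).trans ?_
      rw [Finset.card_univ, pow_succ']
      gcongr
    · intro y hy
      obtain ⟨w, z, hz, rfl⟩ := mem_iUnion.1 (hcov hy)
      obtain ⟨c, hc, hzc⟩ := mem_iUnion₂.1 (hTcov hz)
      exact mem_iUnion₂.2 ⟨F w '' c, Finset.mem_image₂_of_mem (Finset.mem_univ w) hc,
        mem_image_of_mem _ hzc⟩
    · intro c hc
      obtain ⟨w, -, c, hcT, rfl⟩ := Finset.mem_image₂.1 hc
      obtain ⟨hcA, hc⟩ := hT c hcT
      refine ⟨fun y hy => ?_, ?_⟩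
      · obtain ⟨z, hz, rfl⟩ := hy
        exact hmaps w (hcA hz)
      · rintro _ ⟨z, hz, rfl⟩ _ ⟨z', hz', rfl⟩
        obtain ⟨h1, h2⟩ := hc z hz z' hz'
        constructor
        · refine (hdist w z (hcA hz) z' (hcA hz')).trans ?_
          calc ρ * dist z z' ≤ ρ * (R * ρ ^ n) := by gcongr
            _ = R * ρ ^ (n + 1) := by ring
        · refine (hosc w z (hcA hz) z' (hcA hz')).trans ?_
          calc a * |f z - f z'| + K * dist z z' ^ s
              ≤ a * (O * (ρ ^ n) ^ s) + K * (R * ρ ^ n) ^ s := by gcongr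
            _ = (a * O + K * R ^ s) * (ρ ^ n) ^ s := by
                rw [Real.mul_rpow hR (by positivity)]
                ring
            _ ≤ (O * ρ ^ s) * (ρ ^ n) ^ s := by
                gcongr
                linarith
            _ = O * (ρ ^ (n + 1)) ^ s := by
                rw [pow_succ', Real.mul_rpow hρ.le (by positivity)]
                ring

end Cells

/-! ### Covering a graph by balls, cell by cell. -/

section Covering

open Metric

theorem dist_toLp_le (y y' : Plane2) (z z' : ℝ) :
    dist (WithLp.toLp 2 (y, z) : Space5) (WithLp.toLp 2 (y', z')) ≤ dist y y' + |z - z'| := by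
  rw [WithLp.prod_dist_eq_of_L2, Real.sqrt_le_left (by positivity), Real.dist_eq]
  simp only [WithLp.toLp_fst, WithLp.toLp_snd]
  nlinarith [mul_nonneg (dist_nonneg (x := y) (y := y')) (abs_nonneg (z - z'))]

/-- A piece of a graph of small diameter and oscillation `H` is covered by `4 * H / δ + 2` balls of
radius `δ`. -/
theorem exists_cover_graph {f : Plane2 → ℝ} {c : Set Plane2} {δ H : ℝ} (hδ : 0 < δ) (hH : 0 ≤ H)
    (hdist : ∀ y ∈ c, ∀ y' ∈ c, dist y y' ≤ δ / 2) (hosc : ∀ y ∈ c, ∀ y' ∈ c, |f y - f y'| ≤ H) :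
    ∃ C : Finset Space5, (C.card : ℝ) ≤ 4 * H / δ + 2 ∧
      ∀ y ∈ c, ∃ x ∈ C, dist (WithLp.toLp 2 (y, f y) : Space5) x ≤ δ := by
  classical
  rcases c.eq_empty_or_nonempty with rfl | ⟨y₀, hy₀⟩
  · exact ⟨∅, by simpa using by positivity, by simp⟩
  -- Centres are stacked above one base point `y₀` at spacing `δ / 2`; the horizontal and vertical
  -- errors are each at most `δ / 2`.
  refine ⟨(Finset.Icc ⌊-(2 * H / δ)⌋ ⌊2 * H / δ⌋).image
    fun j : ℤ => WithLp.toLp 2 (y₀, f y₀ + j * (δ / 2)), ?_, fun y hy => ?_⟩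
  · have hle : ⌊-(2 * H / δ)⌋ ≤ ⌊2 * H / δ⌋ := by
      apply Int.floor_le_floor
      have : 0 ≤ 2 * H / δ := by positivity
      linarith
    calc ((Finset.image _ _).card : ℝ)
        ≤ ((Finset.Icc ⌊-(2 * H / δ)⌋ ⌊2 * H / δ⌋).card : ℝ) := by
          exact_mod_cast Finset.card_image_le
      _ = ⌊2 * H / δ⌋ + 1 - ⌊-(2 * H / δ)⌋ := by
          have := Int.card_Icc_of_le ⌊-(2 * H / δ)⌋ ⌊2 * H / δ⌋ (by omega)
          exact_mod_cast this
      _ ≤ 4 * H / δ + 2 := by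
          have h1 := Int.floor_le (2 * H / δ)
          have h2 := Int.lt_floor_add_one (-(2 * H / δ))
          have h3 : 4 * H / δ = 2 * (2 * H / δ) := by ring
          linarith
  · set u := (f y - f y₀) / (δ / 2) with hu
    have hfy : f y = f y₀ + u * (δ / 2) := by
      rw [hu]
      field_simp
      ring
    have hub : |u| ≤ 2 * H / δ := by
      rw [hu, abs_div, abs_of_pos (half_pos hδ), div_le_div_iff₀ (half_pos hδ) hδ]
      nlinarith [hosc y hy y₀ hy₀]
    rw [abs_le] at hub
    refine ⟨_, Finset.mem_image_of_mem _ (Finset.mem_Icc.2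
      ⟨Int.floor_le_floor hub.1, Int.floor_le_floor hub.2⟩), ?_⟩
    refine (dist_toLp_le _ _ _ _).trans ?_
    have h1 := hdist y hy y₀ hy₀
    have h2 : |f y - (f y₀ + ⌊u⌋ * (δ / 2))| ≤ δ / 2 := by
      have h3 : f y - (f y₀ + ⌊u⌋ * (δ / 2)) = (u - ⌊u⌋) * (δ / 2) := by
        rw [hfy]
        ring
      rw [h3, abs_mul, abs_of_pos (half_pos hδ), abs_of_nonneg (sub_nonneg.2 (Int.floor_le u))]
      nlinarith [Int.lt_floor_add_one u]
    linarith

theorem externalCoveringNumber_graphOver_le {f : Plane2 → ℝ} {A : Set Plane2}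
    {T : Finset (Set Plane2)} {δ : ℝ≥0} {H : ℝ} (hδ : 0 < δ) (hH : 0 ≤ H)
    (hcov : A ⊆ ⋃ c ∈ T, c) (hdist : ∀ c ∈ T, ∀ y ∈ c, ∀ y' ∈ c, dist y y' ≤ δ / 2)
    (hosc : ∀ c ∈ T, ∀ y ∈ c, ∀ y' ∈ c, |f y - f y'| ≤ H) :
    (externalCoveringNumber δ (graphOver A f) : ℝ≥0∞) ≤
      ENNReal.ofReal (T.card * (4 * H / δ + 2)) := by
  classical
  have h : ∀ c, ∃ C : Finset Space5, c ∈ T → (C.card : ℝ) ≤ 4 * H / δ + 2 ∧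
      ∀ y ∈ c, ∃ x ∈ C, dist (WithLp.toLp 2 (y, f y) : Space5) x ≤ δ := by
    intro c
    by_cases hc : c ∈ T
    · obtain ⟨C, hC⟩ := exists_cover_graph (NNReal.coe_pos.2 hδ) hH (hdist c hc) (hosc c hc)
      exact ⟨C, fun _ => hC⟩
    · exact ⟨∅, fun h => absurd h hc⟩
  choose C hC using h
  have hcover : IsCover δ (graphOver A f) (T.biUnion C : Set Space5) := by
    rw [isCover_iff_subset_iUnion_closedBall]
    rintro _ ⟨y, hy, rfl⟩
    obtain ⟨c, hc, hyc⟩ := mem_iUnion₂.1 (hcov hy)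
    obtain ⟨x, hx, hxy⟩ := (hC c hc).2 y hyc
    exact mem_iUnion₂.2 ⟨x, Finset.mem_coe.2 (Finset.mem_biUnion.2 ⟨c, hc, hx⟩), hxy⟩
  have h1 := hcover.externalCoveringNumber_le_encard
  rw [Set.encard_coe_eq_coe_finsetCard] at h1
  have h2 : (externalCoveringNumber δ (graphOver A f) : ℝ≥0∞) ≤ ((T.biUnion C).card : ℝ≥0∞) := by
    exact_mod_cast h1
  refine h2.trans ?_
  rw [← ENNReal.ofReal_natCast]
  refine ENNReal.ofReal_le_ofReal ?_
  calc ((T.biUnion C).card : ℝ) ≤ ∑ c ∈ T, ((C c).card : ℝ) := by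
        exact_mod_cast Finset.card_biUnion_le
    _ ≤ ∑ c ∈ T, (4 * H / δ + 2) := Finset.sum_le_sum fun c hc => (hC c hc).1
    _ = T.card * (4 * H / δ + 2) := by rw [Finset.sum_const, nsmul_eq_mul]

/-- If `A` splits at every level `n` into at most `m ^ n` cells of diameter `O (ρ ^ n)` on which `f`
oscillates by `O (ρ ^ (s * n))`, where `m = ρ ^ (-D)`, then the graph of `f` has upper box dimension
at most `1 - s + D`. -/
theorem upperBoxDim_graphOver_le {f : Plane2 → ℝ} {A : Set Plane2} {m : ℕ} {ρ D R O s : ℝ}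
    (hρ : 0 < ρ) (hρ1 : ρ < 1) (hs0 : 0 ≤ s) (hs1 : s ≤ 1) (hD : 0 ≤ D) (hR : 1 ≤ R) (hO : 0 ≤ O)
    (hm : (m : ℝ) = ρ ^ (-D))
    (hcells : ∀ n : ℕ, ∃ T : Finset (Set Plane2), T.card ≤ m ^ n ∧ A ⊆ ⋃ c ∈ T, c ∧
      ∀ c ∈ T, ∀ y ∈ c, ∀ y' ∈ c,
        dist y y' ≤ R * ρ ^ n ∧ |f y - f y'| ≤ O * (ρ ^ n) ^ s) :
    upperBoxDim (graphOver A f) ≤ ((1 - s + D : ℝ) : EReal) := by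
  have hR0 : 0 < R := one_pos.trans_le hR
  set C := (ρ / (2 * R)) ^ (-D) * (4 * (O * ((2 * R)⁻¹) ^ s) + 2) with hCdef
  have hC : 0 < C := by positivity
  refine upperBoxDim_le_of_eventually_le hC ?_
  filter_upwards [Ioo_mem_nhdsGT (zero_lt_one' ℝ≥0)] with δ hδ
  have hδ0 : (0 : ℝ) < δ := by exact_mod_cast hδ.1
  have hδ1 : (δ : ℝ) < 1 := by exact_mod_cast hδ.2
  have hx0 : 0 < (δ : ℝ) / (2 * R) := by positivity
  have hx1 : (δ : ℝ) / (2 * R) ≤ 1 := by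
    rw [div_le_one (by positivity)]
    linarith
  -- Level `n + 1` is the scale at which cell diameters `R * ρ ^ (n + 1)` fall below `δ / 2`, while
  -- `ρ ^ (n + 1)` stays comparable to `δ`.
  obtain ⟨n, hn1, hn2⟩ := exists_nat_pow_near_of_lt_one hx0 hx1 hρ hρ1
  obtain ⟨T, hcard, hcov, hT⟩ := hcells (n + 1)
  have hlow : ρ / (2 * R) * δ ≤ ρ ^ (n + 1) := by
    calc ρ / (2 * R) * δ = ρ * (δ / (2 * R)) := by ring
      _ ≤ ρ * ρ ^ n := by gcongr
      _ = ρ ^ (n + 1) := by ring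
  have hcard' : (T.card : ℝ) ≤ (ρ / (2 * R)) ^ (-D) * (δ : ℝ) ^ (-D) := by
    calc (T.card : ℝ) ≤ (m : ℝ) ^ (n + 1) := by exact_mod_cast hcard
      _ = (ρ ^ (n + 1)) ^ (-D) := by
          rw [hm, ← Real.rpow_natCast, ← Real.rpow_natCast, ← Real.rpow_mul hρ.le,
            ← Real.rpow_mul hρ.le, mul_comm]
      _ ≤ (ρ / (2 * R) * δ) ^ (-D) :=
          Real.rpow_le_rpow_of_nonpos (by positivity) hlow (by linarith)
      _ = _ := Real.mul_rpow (by positivity) hδ0.le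
  have hosc : O * (ρ ^ (n + 1)) ^ s ≤ O * ((2 * R)⁻¹) ^ s * (δ : ℝ) ^ s := by
    calc O * (ρ ^ (n + 1)) ^ s ≤ O * (δ / (2 * R)) ^ s := by gcongr
      _ = O * ((2 * R)⁻¹) ^ s * (δ : ℝ) ^ s := by
          rw [div_eq_inv_mul, Real.mul_rpow (by positivity) hδ0.le, mul_assoc]
  refine (externalCoveringNumber_graphOver_le hδ.1 (H := O * ((2 * R)⁻¹) ^ s * (δ : ℝ) ^ s)
    (by positivity) hcov
    (fun c hc y hy y' hy' => ((hT c hc y hy y' hy').1).trans ?_)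
    (fun c hc y hy y' hy' => ((hT c hc y hy y' hy').2).trans hosc)).trans
    (ENNReal.ofReal_le_ofReal ?_)
  · calc R * ρ ^ (n + 1) ≤ R * (δ / (2 * R)) := by gcongr
      _ = δ / 2 := by field_simp
  -- Since `s ≤ 1` and `δ < 1`, the additive 2 is absorbed into `2 * δ ^ (s - 1)`.
  · have h1 : (1 : ℝ) ≤ (δ : ℝ) ^ (s - 1) :=
      Real.one_le_rpow_of_pos_of_le_one_of_nonpos hδ0 hδ1.le (by linarith)
    have h2 : (δ : ℝ) ^ (s - 1) = (δ : ℝ) ^ s / δ := Real.rpow_sub_one hδ0.ne' s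
    calc (T.card : ℝ) * (4 * (O * ((2 * R)⁻¹) ^ s * (δ : ℝ) ^ s) / δ + 2)
        ≤ ((ρ / (2 * R)) ^ (-D) * (δ : ℝ) ^ (-D)) *
          (4 * (O * ((2 * R)⁻¹) ^ s) * (δ : ℝ) ^ (s - 1) + 2 * (δ : ℝ) ^ (s - 1)) := by
          refine mul_le_mul hcard' ?_ (by positivity) (by positivity)
          rw [h2] at h1 ⊢
          have h3 : 4 * (O * ((2 * R)⁻¹) ^ s * (δ : ℝ) ^ s) / δ =
            4 * (O * ((2 * R)⁻¹) ^ s) * ((δ : ℝ) ^ s / δ) := by ring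
          rw [h3]
          linarith
      _ = C * ((δ : ℝ) ^ (-D) * (δ : ℝ) ^ (s - 1)) := by
          rw [hCdef]
          ring
      _ = C * (δ : ℝ) ^ (-(1 - s + D)) := by
          rw [← Real.rpow_add hδ0]
          ring_nf

end Covering

/-! ### Barycentric coordinates and the lower bound. -/

section LowerBound

theorem contDiff_affineMap (g : Plane →ᵃ[ℝ] ℝ) : ContDiff ℝ 1 g :=
  ContinuousAffineMap.contDiff ⟨g, g.continuous_of_finiteDimensional⟩

/-- The vertices of a triangle in the plane form an affine basis. -/
noncomputable def triangleBasis (P : Affine.Triangle ℝ Plane) : AffineBasis (Fin 3) ℝ Plane where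
  toFun := P.points
  ind' := P.independent
  tot' := by
    rw [P.independent.affineSpan_eq_top_iff_card_eq_finrank_add_one]
    simp

/-- `halfMap` takes the midpoint with a vertex, affine coordinates preserve midpoints, and vertices
have 0-1 coordinates. -/
theorem triangleBasis_coord_halfMap (P : Affine.Triangle ℝ Plane) (i j : Fin 3) (t : Plane) :
    (triangleBasis P).coord i (halfMap P.points j t) =
      ((triangleBasis P).coord i t + if i = j then 1 else 0) / 2 := by
  have h : halfMap P.points j t = midpoint ℝ t (triangleBasis P j) := by
    rw [midpoint_eq_smul_add, halfMap, invOf_eq_inv, one_div]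
    rfl
  rw [h, AffineMap.map_midpoint, AffineBasis.coord_apply, midpoint_eq_smul_add, invOf_eq_inv,
    smul_eq_mul, inv_mul_eq_div]

theorem halfMap_mem_gasket {p : Fin 3 → Plane} {t : Plane} (ht : t ∈ gasket p) (i : Fin 3) :
    halfMap p i t ∈ gasket p := by
  rw [(isAttractor_gasket p).2.2]
  exact mem_iUnion.2 ⟨i, t, ht, rfl⟩

/-- The barycentric coordinates of the two planar components with respect to two triangles. -/
noncomputable def barycentric (P Q : Affine.Triangle ℝ Plane) (x : Space5) : Fin 3 ⊕ Fin 3 → ℝ :=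
  Sum.elim (fun i => (triangleBasis P).coord i x.fst.fst)
    (fun i => (triangleBasis Q).coord i x.fst.snd)

theorem contDiff_barycentric (P Q : Affine.Triangle ℝ Plane) : ContDiff ℝ 1 (barycentric P Q) := by
  refine contDiff_pi.2 fun i => ?_
  rcases i with i | i
  · exact (contDiff_affineMap _).comp
      ((WithLp.fstL 2 ℝ Plane Plane).comp (WithLp.fstL 2 ℝ Plane2 ℝ)).contDiff
  · exact (contDiff_affineMap _).comp
      ((WithLp.sndL 2 ℝ Plane Plane).comp (WithLp.fstL 2 ℝ Plane2 ℝ)).contDiff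

/-- A compact graph over the product of two gaskets has Hausdorff dimension at least
`2 * log 3 / log 2`. -/
theorem le_dimH_graphOver_gasketProd (P Q : Affine.Triangle ℝ Plane) (f : Plane2 → ℝ)
    (hne : (graphOver (gasketProd P.points Q.points) f).Nonempty)
    (hcpt : IsCompact (graphOver (gasketProd P.points Q.points) f)) :
    ENNReal.ofReal (2 * (Real.log 3 / Real.log 2)) ≤
      dimH (graphOver (gasketProd P.points Q.points) f) := by
  set Γ := graphOver (gasketProd P.points Q.points) f with hΓ
  let e : Fin 3 × Fin 3 → Fin 3 ⊕ Fin 3 → ℤ := fun d =>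
    Sum.elim (fun i => if i = d.1 then 1 else 0) (fun i => if i = d.2 then 1 else 0)
  have he : Function.Injective e := by
    rintro ⟨a, b⟩ ⟨a', b'⟩ h
    have h1 := congrFun h (.inl a)
    have h2 := congrFun h (.inr b)
    simp only [e, Sum.elim_inl, Sum.elim_inr, if_true] at h1 h2
    split_ifs at h1 h2 with h3 h4
    · rw [h3, h4]
    all_goals simp_all
  have h01 : ∀ d i, 0 ≤ e d i ∧ e d i ≤ 1 := by
    rintro d (i | i) <;> simp only [e, Sum.elim_inl, Sum.elim_inr] <;> split_ifs <;> simp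
  have hlow : ENNReal.ofReal (Real.log (Fintype.card (Fin 3 × Fin 3)) / Real.log 2) ≤
      dimH (barycentric P Q '' Γ) := by
    refine log_card_div_log_two_le_dimH he h01 (by simp) (hne.image _)
      (hcpt.image (contDiff_barycentric P Q).continuous).isClosed ?_
    rintro ⟨a, b⟩ _ ⟨_, ⟨y, hy, rfl⟩, rfl⟩
    -- Barycentric coordinates ignore the height, so the graph point above the image of the base
    -- point serves as preimage.
    refine ⟨_, ⟨WithLp.toLp 2 (halfMap P.points a y.fst, halfMap Q.points b y.snd),
      ⟨halfMap_mem_gasket hy.1 a, halfMap_mem_gasket hy.2 b⟩, rfl⟩, ?_⟩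
    funext i
    rcases i with i | i <;>
      simp [barycentric, e, triangleBasis_coord_halfMap]
  have hlog : Real.log (Fintype.card (Fin 3 × Fin 3)) / Real.log 2 =
      2 * (Real.log 3 / Real.log 2) := by
    have h9 : ((Fintype.card (Fin 3 × Fin 3) : ℕ) : ℝ) = 3 ^ 2 := by
      rw [Fintype.card_prod, Fintype.card_fin]
      norm_num
    rw [h9, Real.log_pow]
    push_cast
    ring
  rw [← hlog]
  exact hlow.trans
    ((contDiff_barycentric P Q).contDiffOn.dimH_image_le convex_univ (subset_univ _))

end LowerBound

/-! ### Self-similarity of the interpolation function and the upper bound. -/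

section UpperBound

theorem dist_wordMap (p : Fin 3 → Plane) {N : ℕ} (ω : Word N) (t t' : Plane) :
    dist (wordMap p ω t) (wordMap p ω t') = (1 / 2) ^ N * dist t t' := by
  have h : ∀ l : List (Fin 3), dist (l.foldr (halfMap p) t) (l.foldr (halfMap p) t') =
      (1 / 2) ^ l.length * dist t t' := by
    intro l
    induction l with
    | nil => simp
    | cons i l ih =>
      rw [List.foldr_cons, List.foldr_cons, halfMap, halfMap, dist_smul₀, dist_add_right, ih,
        Real.norm_of_nonneg (by norm_num), List.length_cons, pow_succ', mul_assoc]
  simpa [wordMap] using h (List.ofFn ω)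

/-- The action of a pair of words on the product of the planes. -/
noncomputable def wordMap2 (p q : Fin 3 → Plane) {N : ℕ} (w : Word N × Word N) (y : Plane2) :
    Plane2 :=
  WithLp.toLp 2 (wordMap p w.1 y.fst, wordMap q w.2 y.snd)

theorem dist_wordMap2 (p q : Fin 3 → Plane) {N : ℕ} (w : Word N × Word N) (y y' : Plane2) :
    dist (wordMap2 p q w y) (wordMap2 p q w y') = (1 / 2) ^ N * dist y y' := by
  rw [WithLp.prod_dist_eq_of_L2, WithLp.prod_dist_eq_of_L2]
  simp only [wordMap2, WithLp.toLp_fst, WithLp.toLp_snd, dist_wordMap]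
  rw [mul_pow, mul_pow, ← mul_add, Real.sqrt_mul (by positivity), Real.sqrt_sq (by positivity)]

section

variable {p q : Fin 3 → Plane} {N : ℕ} {α h : Word N × Word N → Plane2 → ℝ} {f : Plane2 → ℝ}

/-- The image of a graph point lies on the graph again, and a graph has just one point above each
base point. -/
theorem IsFIF.wordMap2_mem_and_apply (hf : IsFIF p q α h f) (w : Word N × Word N) {y : Plane2}
    (hy : y ∈ gasketProd p q) : wordMap2 p q w y ∈ gasketProd p q ∧
      f (wordMap2 p q w y) = α w y * f y + h w y := by
  have hmem : fifSystem p q α h w (WithLp.toLp 2 (y, f y)) ∈ graphOver (gasketProd p q) f := by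
    rw [hf.2.2]
    exact mem_iUnion.2 ⟨w, _, mem_image_of_mem _ hy, rfl⟩
  obtain ⟨z, hz, hzw⟩ := hmem
  have h1 : z = wordMap2 p q w y := congrArg WithLp.fst hzw
  have h2 : f z = α w y * f y + h w y := congrArg WithLp.snd hzw
  exact h1 ▸ ⟨hz, h2⟩

theorem IsFIF.subset_iUnion_wordMap2 (hf : IsFIF p q α h f) :
    gasketProd p q ⊆ ⋃ w : Word N × Word N, wordMap2 p q w '' gasketProd p q := by
  intro y hy
  have hmem : (WithLp.toLp 2 (y, f y) : Space5) ∈ graphOver (gasketProd p q) f :=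
    mem_image_of_mem _ hy
  rw [hf.2.2] at hmem
  obtain ⟨w, _, ⟨z, hz, rfl⟩, hzw⟩ := mem_iUnion.1 hmem
  exact mem_iUnion.2 ⟨w, z, hz, congrArg WithLp.fst hzw⟩

theorem IsFIF.exists_dist_le (hf : IsFIF p q α h f) :
    ∃ R : ℝ, 1 ≤ R ∧ ∀ y ∈ gasketProd p q, ∀ y' ∈ gasketProd p q, dist y y' ≤ R := by
  obtain ⟨R, hR⟩ := Metric.isBounded_iff.1
    (hf.2.1.image (WithLp.fstL 2 ℝ Plane2 ℝ).continuous).isBounded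
  refine ⟨max 1 R, le_max_left _ _, fun y hy y' hy' => le_trans ?_ (le_max_right _ _)⟩
  exact hR (mem_image_of_mem _ (mem_image_of_mem _ hy))
    (mem_image_of_mem _ (mem_image_of_mem _ hy'))

theorem IsFIF.exists_abs_le (hf : IsFIF p q α h f) :
    ∃ M : ℝ, 0 ≤ M ∧ ∀ y ∈ gasketProd p q, |f y| ≤ M := by
  obtain ⟨M, hM⟩ := (hf.2.1.image (WithLp.sndL 2 ℝ Plane2 ℝ).continuous).isBounded.exists_norm_le
  refine ⟨max 0 M, le_max_left _ _, fun y hy => le_trans ?_ (le_max_right _ _)⟩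
  exact hM _ (mem_image_of_mem _ (mem_image_of_mem _ hy))

end

/-- On a set of diameter at most `R` a Hölder exponent may be lowered: the surplus factor `dist ^ (σ
- s)` is at most `R`, as `R ≥ 1` and `σ - s ≤ 1`. -/
theorem abs_sub_le_of_holderOnWith {A : Set Plane2} {g : Plane2 → ℝ} {K σ : ℝ≥0} {R s : ℝ}
    (hg : HolderOnWith K σ g A) (hs : 0 ≤ s) (hsσ : s ≤ σ) (hσ : σ ≤ 1) (hR : 1 ≤ R)
    (hdiam : ∀ y ∈ A, ∀ y' ∈ A, dist y y' ≤ R) {y y' : Plane2} (hy : y ∈ A) (hy' : y' ∈ A) :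
    |g y - g y'| ≤ K * R * dist y y' ^ s := by
  have h1 := hg.dist_le hy hy'
  rw [Real.dist_eq] at h1
  refine h1.trans ?_
  have hσ' : (σ : ℝ) ≤ 1 := by exact_mod_cast hσ
  have h2 : dist y y' ^ (σ - s : ℝ) ≤ R := by
    calc dist y y' ^ (σ - s : ℝ) ≤ R ^ (σ - s : ℝ) :=
          Real.rpow_le_rpow dist_nonneg (hdiam y hy y' hy') (by linarith)
      _ ≤ R ^ (1 : ℝ) := Real.rpow_le_rpow_of_exponent_le hR (by linarith)
      _ = R := Real.rpow_one R
  calc (K : ℝ) * dist y y' ^ (σ : ℝ) = K * (dist y y' ^ (σ - s : ℝ) * dist y y' ^ s) := by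
        rw [← Real.rpow_add_of_nonneg dist_nonneg (by linarith) hs]
        ring_nf
    _ ≤ K * (R * dist y y' ^ s) := by gcongr
    _ = _ := by ring

/-- Boundedness is essential: a real `⨆` over an unbounded family takes the default value 0. -/
theorem abs_le_supNorm {N : ℕ} {A : Set Plane2} {α : Word N × Word N → Plane2 → ℝ}
    (hb : ∀ w, ∃ B, ∀ y ∈ A, |α w y| ≤ B) (w : Word N × Word N) {y : Plane2} (hy : y ∈ A) :
    |α w y| ≤ supNorm A α := by
  obtain ⟨B, hB⟩ := hb w
  have h1 : |α w y| ≤ ⨆ y : A, |α w y| :=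
    le_ciSup (f := fun y : A => |α w y|) ⟨B, by rintro _ ⟨z, rfl⟩; exact hB z z.2⟩ ⟨y, hy⟩
  exact h1.trans (le_ciSup (f := fun w => ⨆ y : A, |α w y|) (finite_range _).bddAbove w)

theorem card_word_prod (N : ℕ) :
    (Fintype.card (Word N × Word N) : ℝ) =
      ((1 / 2 : ℝ) ^ N) ^ (-(2 * (Real.log 3 / Real.log 2))) := by
  have h2 : (2 : ℝ) ^ (Real.log 3 / Real.log 2) = 3 := by
    rw [Real.rpow_def_of_pos (by norm_num), mul_div_cancel₀ _ (Real.log_pos (by norm_num)).ne',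
      Real.exp_log (by norm_num)]
  rw [one_div, inv_pow, Real.inv_rpow (by positivity), Real.rpow_neg (by positivity), inv_inv,
    ← Real.rpow_natCast, ← Real.rpow_mul (by norm_num),
    show (N : ℝ) * (2 * (Real.log 3 / Real.log 2)) = Real.log 3 / Real.log 2 * (N * 2 : ℕ) by
      push_cast; ring, Real.rpow_mul (by norm_num), h2, Real.rpow_natCast]
  simp only [Fintype.card_prod, Fintype.card_fun, Fintype.card_fin]
  push_cast
  ring

/-- The graph of a fractal interpolation function with vertical scaling below `2 ^ (-N)` and Hölder
data of exponents at least `s` has upper box dimension at most `1 - s + 2 * log 3 / log 2`. -/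
theorem IsFIF.upperBoxDim_graphOver_le {p q : Fin 3 → Plane} {N : ℕ} (hN : 1 ≤ N)
    {α h : Word N × Word N → Plane2 → ℝ} {f : Plane2 → ℝ} (hf : IsFIF p q α h f)
    {Kh sh : ℝ≥0} (hsh : sh ≤ 1) (hh : ∀ w, HolderOnWith Kh sh (h w) (gasketProd p q))
    {Kα sα : Word N × Word N → ℝ≥0} (hsα : ∀ w, sα w ≤ 1)
    (hα : ∀ w, HolderOnWith (Kα w) (sα w) (α w) (gasketProd p q))
    (hnorm : supNorm (gasketProd p q) α < 1 / 2 ^ N) {s : ℝ} (hs0 : 0 ≤ s) (hs1 : s ≤ sh)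
    (hs2 : ∀ w, s ≤ sα w) :
    upperBoxDim (graphOver (gasketProd p q) f) ≤
      ((1 - s + 2 * (Real.log 3 / Real.log 2) : ℝ) : EReal) := by
  set A := gasketProd p q with hA
  obtain ⟨R, hR, hdiam⟩ := hf.exists_dist_le
  obtain ⟨M, hM0, hM⟩ := hf.exists_abs_le
  have hAne : A.Nonempty := hf.1.of_image
  have hsle : s ≤ 1 := hs1.trans (by exact_mod_cast hsh)
  have hρ1 : (1 / 2 : ℝ) ^ N < 1 := pow_lt_one₀ (by norm_num) (by norm_num) (by omega)
  have hαb : ∀ w, ∀ y ∈ A, |α w y| ≤ supNorm A α := fun w y hy => by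
    refine abs_le_supNorm (fun w => ?_) w hy
    obtain ⟨y₀, hy₀⟩ := hAne
    refine ⟨|α w y₀| + Kα w * R * R ^ s, fun y hy => ?_⟩
    have h1 := abs_sub_le_of_holderOnWith (hα w) hs0 (hs2 w) (hsα w) hR hdiam hy hy₀
    have h2 : Kα w * R * dist y y₀ ^ s ≤ Kα w * R * R ^ s := by
      gcongr
      exact hdiam y hy y₀ hy₀
    have h3 := abs_sub_abs_le_abs_sub (α w y) (α w y₀)
    linarith
  have ha0 : 0 ≤ supNorm A α := by
    obtain ⟨y₀, hy₀⟩ := hAne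
    exact (abs_nonneg _).trans (hαb 0 y₀ hy₀)
  -- The threshold `2 ^ (-N)` works for every `s ≤ 1`, because raising a number in `(0, 1)` to the
  -- power `s` does not decrease it.
  have hnorm' : supNorm A α < ((1 / 2 : ℝ) ^ N) ^ s := by
    refine lt_of_lt_of_le (b := (1 / 2 : ℝ) ^ N) (by rwa [one_div_pow]) ?_
    calc (1 / 2 : ℝ) ^ N = ((1 / 2 : ℝ) ^ N) ^ (1 : ℝ) := (Real.rpow_one _).symm
      _ ≤ ((1 / 2 : ℝ) ^ N) ^ s :=
        Real.rpow_le_rpow_of_exponent_ge (by positivity) hρ1.le hsle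
  -- The Hölder term collects the variation of `α`, multiplied by the bound `M` for `f`, and that of
  -- `h`; the sum over `w` makes it uniform.
  set K : ℝ := (∑ w, (Kα w : ℝ)) * R * M + Kh * R with hK
  have hKα : ∀ w, (Kα w : ℝ) ≤ ∑ w, (Kα w : ℝ) := fun w =>
    Finset.single_le_sum (f := fun w => (Kα w : ℝ)) (fun _ _ => NNReal.coe_nonneg _)
      (Finset.mem_univ w)
  have hsum : 0 ≤ ∑ w, (Kα w : ℝ) := Finset.sum_nonneg fun _ _ => NNReal.coe_nonneg _
  have hosc : ∀ w : Word N × Word N, ∀ y ∈ A, ∀ y' ∈ A,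
      |f (wordMap2 p q w y) - f (wordMap2 p q w y')| ≤
      supNorm A α * |f y - f y'| + K * dist y y' ^ s := by
    intro w y hy y' hy'
    rw [(hf.wordMap2_mem_and_apply w hy).2, (hf.wordMap2_mem_and_apply w hy').2]
    have h1 := abs_sub_le_of_holderOnWith (hα w) hs0 (hs2 w) (hsα w) hR hdiam hy hy'
    have h2 := abs_sub_le_of_holderOnWith (hh w) hs0 hs1 hsh hR hdiam hy hy'
    have hd : 0 ≤ dist y y' ^ s := Real.rpow_nonneg dist_nonneg s
    calc |α w y * f y + h w y - (α w y' * f y' + h w y')|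
        = |α w y * (f y - f y') + (α w y - α w y') * f y' + (h w y - h w y')| := by
          congr 1
          ring
      _ ≤ |α w y| * |f y - f y'| + |α w y - α w y'| * |f y'| + |h w y - h w y'| := by
          rw [← abs_mul, ← abs_mul]
          exact abs_add_three _ _ _
      _ ≤ supNorm A α * |f y - f y'| + ((∑ w, (Kα w : ℝ)) * R * dist y y' ^ s) * M +
          Kh * R * dist y y' ^ s := by
          have h3 : |α w y - α w y'| ≤ (∑ w, (Kα w : ℝ)) * R * dist y y' ^ s := by
            refine h1.trans ?_
            gcongr
            exact hKα w
          gcongr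
          · exact hαb w y hy
          · exact hM y' hy'
      _ = _ := by
          rw [hK]
          ring
  obtain ⟨O, hO, hcells⟩ := exists_cells (A := A) (F := wordMap2 p q (N := N)) (f := f)
    (ρ := (1 / 2) ^ N) (a := supNorm A α) (K := K) (R := R) (M := M + M) (s := s)
    (by positivity) hs0 ha0 hnorm' (by positivity) (by positivity) hf.subset_iUnion_wordMap2
    (fun w y hy => (hf.wordMap2_mem_and_apply w hy).1)
    (fun w y _ y' _ => (dist_wordMap2 p q w y y').le) hosc hdiam
    (fun y hy y' hy' => (abs_sub _ _).trans (add_le_add (hM y hy) (hM y' hy')))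
  refine GasketFIF.upperBoxDim_graphOver_le (by positivity) hρ1 hs0 hsle ?_ hR hO
    (card_word_prod N) fun n => ?_
  · have h3 := Real.log_nonneg (by norm_num : (1 : ℝ) ≤ 3)
    have h2 := Real.log_nonneg (by norm_num : (1 : ℝ) ≤ 2)
    positivity
  · obtain ⟨T, h1, h2, h3⟩ := hcells n
    exact ⟨T, h1, h2, fun c hc => (h3 c hc).2⟩

end UpperBound

end GasketFIF

open GasketFIF
theorem mainTheorem3 (P Q : Affine.Triangle ℝ Plane) (hP : P.Equilateral) (hQ : Q.Equilateral)
    (N : ℕ) (hN : 1 ≤ N) (α h : Word N × Word N → Plane2 → ℝ) (f : Plane2 → ℝ)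
    (hf : IsFIF P.points Q.points α h f)
    (Kh sh : ℝ≥0) (hsh : 0 < sh ∧ sh ≤ 1)
    (hh : ∀ w, HolderOnWith Kh sh (h w) (gasketProd P.points Q.points))
    (Kα sα : Word N × Word N → ℝ≥0) (hsα : ∀ w, 0 < sα w ∧ sα w ≤ 1)
    (hα : ∀ w, HolderOnWith (Kα w) (sα w) (α w) (gasketProd P.points Q.points))
    (hnorm : supNorm (gasketProd P.points Q.points) α < 1 / 2 ^ N)
    (s : ℝ) (hs : s = min (sh : ℝ) (⨅ w, (sα w : ℝ))) :
    ((2 * (Real.log 3 / Real.log 2) : ℝ) : EReal)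
        ≤ (dimH (graphOver (gasketProd P.points Q.points) f) : EReal) ∧
      (dimH (graphOver (gasketProd P.points Q.points) f) : EReal)
        ≤ upperBoxDim (graphOver (gasketProd P.points Q.points) f) ∧
      upperBoxDim (graphOver (gasketProd P.points Q.points) f)
        ≤ ((1 - s + 2 * (Real.log 3 / Real.log 2) : ℝ) : EReal) := by
  refine ⟨?_, dimH_le_upperBoxDim hf.1, ?_⟩
  · have h1 := le_dimH_graphOver_gasketProd P Q f hf.1 hf.2.1
    -- `ENNReal.ofReal` truncates at zero, which can only increase the value.
    have h2 : ((2 * (Real.log 3 / Real.log 2) : ℝ) : EReal) ≤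
        (ENNReal.ofReal (2 * (Real.log 3 / Real.log 2)) : EReal) := by
      rw [EReal.coe_ennreal_ofReal]
      exact_mod_cast le_max_left _ _
    exact h2.trans (by exact_mod_cast h1)
  · refine hf.upperBoxDim_graphOver_le hN hsh.2 hh (fun w => (hsα w).2) hα hnorm ?_ ?_ fun w => ?_
    · rw [hs]
      exact le_min sh.coe_nonneg (Real.iInf_nonneg fun w => (sα w).coe_nonneg)
    · exact hs ▸ min_le_left _ _
    · rw [hs]
      exact (min_le_right _ _).trans (ciInf_le (finite_range _).bddBelow w)
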